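/- Let $K$ be a non-empty finite regular cell complex, that is, a finite CW complex (Hausdorff, with each $n$-cell attached by a given characteristic map from the closed $n$-ball) in which every characteristic map is injective on the whole closed ball, and in which the boundary $\partial C$ of every closed cell $C$ (the image of the boundary sphere, a sphere $S^{\dim C-1}$, with $S^{-1}=\varnothing$) is a union of closed cells. A cell is maximal if its closed cell is not contained in any other closed cell. Suppose that $K$ admits a topological shelling $C_1,C_2,\ldots,C_k$: an enumeration of all the maximal (closed) cells of $K$, each listed exactly once, such that $\dim C_1\ge \dim C_2\ge\cdots\ge\dim C_k$ and for every $j>1$ at least one of the following holds: (a) $\left(\bigcup_{i<j}C_i\right)\cap C_j$ is a (non-empty) contractible subset of $\partial C_j$; (b) $\left(\bigcup_{i<j}C_i\right)\cap C_j=\partial C_j$. Put $n_j:=\dim C_j$ and $S:=\{\,j>1 \mid (\bigcup_{i<j}C_i)\cap C_j=\partial C_j\,\}$. Then $K$ is homotopy equivalent to the wedge of spheres $\bigvee_{j\in S}S^{n_j}$, where the wedge over $S=\varnothing$ is a single point. -/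

import Mathlib

open Set Metric
open scoped Topology ContinuousMap

namespace TopShelling

/-- The identifications made in a wedge: every base point `p i` is glued to one common point. -/
inductive WedgeRel {ι : Type*} (X : ι → Type*) (p : ∀ i, X i) :
    PUnit.{1} ⊕ (Σ i, X i) → PUnit.{1} ⊕ (Σ i, X i) → Prop
  | glue (i : ι) : WedgeRel X p (Sum.inl PUnit.unit) (Sum.inr ⟨i, p i⟩)

/-- The wedge of the pointed spaces `(X i, p i)`: the quotient of the disjoint union of a point and
all the `X i` in which all base points are identified with that point. The wedge of the empty
family is a single point. -/
def Wedge {ι : Type*} (X : ι → Type*) (p : ∀ i, X i) : Type _ :=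
  Quot (WedgeRel X p)

/-- The wedge carries the quotient topology of the disjoint union topology. -/
instance {ι : Type*} (X : ι → Type*) (p : ∀ i, X i) [∀ i, TopologicalSpace (X i)] :
    TopologicalSpace (Wedge X p) :=
  inferInstanceAs (TopologicalSpace (Quot (WedgeRel X p)))

/-- The standard `n`-sphere, the unit sphere of Euclidean `(n + 1)`-space. -/
abbrev Sphere (n : ℕ) : Type :=
  sphere (0 : EuclideanSpace ℝ (Fin (n + 1))) 1

/-- The base point `(1, 0, …, 0)` of the standard `n`-sphere. -/
noncomputable def sphereBase (n : ℕ) : Sphere n :=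
  ⟨EuclideanSpace.single 0 1, by simp⟩

section Complex

variable {X : Type*} [TopologicalSpace X] (C : Set X) [Topology.CWComplex C]

/-- The cells of a CW complex, of all dimensions; the first component is the dimension. -/
abbrev Cell : Type _ := Σ n : ℕ, Topology.RelCWComplex.cell C n

variable {C}

/-- The closed cell. -/
abbrev closedCell (c : Cell C) : Set X := Topology.RelCWComplex.closedCell c.1 c.2

/-- The boundary of a cell: the image of the boundary sphere under the characteristic map. -/
abbrev boundary (c : Cell C) : Set X := Topology.RelCWComplex.cellFrontier c.1 c.2

variable (C)

/-- A CW complex is regular if its closed cells are balls, embedded by their characteristic maps, and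
the boundary of each cell is a union of closed cells (the usual combinatorial definition of a regular
cell complex). In a Hausdorff space, injectivity on the closed ball makes the characteristic map a
homeomorphism of the closed ball onto the closed cell, and of its boundary sphere onto the boundary
of the cell. The definition of a regular CW complex by the first property alone is equivalent. -/
structure IsRegular : Prop where
  injOn : ∀ c : Cell C, InjOn (Topology.RelCWComplex.map c.1 c.2) (closedBall 0 1)
  boundary_eq : ∀ c : Cell C, ∃ S : Set (Cell C), boundary c = ⋃ d ∈ S, closedCell d

variable {C}

/-- A cell is maximal if its closed cell lies in no other closed cell. -/
def IsMaximalCell (c : Cell C) : Prop :=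
  ∀ d : Cell C, closedCell c ⊆ closedCell d → d = c

/-- The part of the cell `e j` that lies in the union of the preceding cells of the list `e`. -/
def attachingSet {k : ℕ} (e : Fin k → Cell C) (j : Fin k) : Set X :=
  (⋃ i : Fin k, ⋃ _ : i < j, closedCell (e i)) ∩ closedCell (e j)

/-- A list `e` of cells is a topological shelling if it lists the maximal cells, each exactly once,
in order of non-increasing dimension, and each cell but the first meets the union of the preceding
ones in a (non-empty) contractible subset of its boundary or in its whole boundary. -/
structure IsTopologicalShelling {k : ℕ} (e : Fin k → Cell C) : Prop where
  injective : Function.Injective e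
  mem_range_iff : ∀ c : Cell C, c ∈ range e ↔ IsMaximalCell c
  dim_le : ∀ i j : Fin k, i ≤ j → (e j).1 ≤ (e i).1
  attach : ∀ j : Fin k, 0 < (j : ℕ) →
    (attachingSet e j ⊆ boundary (e j) ∧ ContractibleSpace (attachingSet e j)) ∨
      attachingSet e j = boundary (e j)

/-- The indices `j`, the first one excluded, for which the `j`-th cell is attached along its whole
boundary sphere. -/
abbrev SphereIndex {k : ℕ} (e : Fin k → Cell C) : Type :=
  {j : Fin k // 0 < (j : ℕ) ∧ attachingSet e j = boundary (e j)}

end Complex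

end TopShelling

/-! Delete from `K` the open cells of those cells that are attached along their whole boundary; what
remains is `trunk e k`. The open cell of a maximal cell meets no other closed cell
(`IsRegular.eq_of_isMaximalCell`), so the trunk is a subcomplex, and it contains the boundaries of
the deleted cells.

The trunk is contractible (`contractsIn_trunk`). In shelling order, the first cell is a ball, a cell
attached along its whole boundary adds nothing, and any other cell is a ball glued on along a
contractible set. Such gluing preserves contractibility (`ContractsIn.union`), because pairs of
subcomplexes have the homotopy extension property (`IsRegular.isCofib`).

By the same property, a contraction of the trunk extends to a homotopy of the identity of `K`, so
collapsing the trunk is a homotopy equivalence (`nonempty_homotopyEquiv_of_collapse`). The collapse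
crushes the boundary of each deleted cell to a point, which makes the cell a sphere and the quotient
the wedge (`exists_collapse_trunk`). -/

namespace TopShelling

open scoped unitInterval

/-! ### Homotopy extension for pairs of subsets -/

section Cofibration

variable {X Y Z : Type*} [TopologicalSpace X] [TopologicalSpace Y] [TopologicalSpace Z]

/-- The pair `(B, A)` of subsets has the homotopy extension property: there is a retraction of
`B × I` onto `B × {0} ∪ A × I`. -/
def IsCofib (A B : Set X) : Prop :=
  ∃ r : X × I → X × I, ContinuousOn r (B ×ˢ univ) ∧
    (∀ p ∈ B ×ˢ univ, (r p).1 ∈ B ∧ ((r p).2 = 0 ∨ (r p).1 ∈ A)) ∧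
    ∀ p ∈ B ×ˢ univ, (p.2 = 0 ∨ p.1 ∈ A) → r p = p

theorem IsCofib.refl (A : Set X) : IsCofib A A :=
  ⟨id, continuousOn_id, fun _ hp => ⟨hp.1, .inr hp.1⟩, fun _ _ _ => rfl⟩

/-- The homotopy extension property. -/
theorem IsCofib.exists_extension {A B : Set X} (h : IsCofib A B) (hAB : A ⊆ B) (hA : IsClosed A)
    (hB : IsClosed B) {f : X → Z} (hf : ContinuousOn f B) {H : X × I → Z}
    (hH : ContinuousOn H (A ×ˢ univ)) (h0 : ∀ x ∈ A, H (x, 0) = f x) {S : Set Z}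
    (hfS : MapsTo f B S) (hHS : MapsTo H (A ×ˢ univ) S) :
    ∃ G : X × I → Z, ContinuousOn G (B ×ˢ univ) ∧ MapsTo G (B ×ˢ univ) S ∧
      (∀ x ∈ B, G (x, 0) = f x) ∧ ∀ p ∈ A ×ˢ univ, G p = H p := by
  classical
  obtain ⟨r, hr, hr1, hr2⟩ := h
  -- The prescribed data on `A × I ∪ B × {0}`; composing with the retraction `r` extends it to `B ×
  -- I`.
  let g : X × I → Z := fun p => if p.1 ∈ A then H p else f p.1
  have hg : ContinuousOn g (A ×ˢ univ ∪ B ×ˢ {0}) := by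
    refine ContinuousOn.union_of_isClosed ?_ ?_ (hA.prod isClosed_univ)
      (hB.prod isClosed_singleton)
    · exact hH.congr fun p hp => if_pos hp.1
    · refine (hf.comp continuousOn_fst fun p hp => hp.1).congr ?_
      rintro ⟨x, t⟩ ⟨hx, ht⟩
      obtain rfl : t = 0 := ht
      by_cases hxA : x ∈ A
      · simp [g, hxA, h0]
      · simp [g, hxA]
  refine ⟨g ∘ r, hg.comp hr ?_, ?_, ?_, ?_⟩
  · intro p hp
    rcases hr1 p hp with ⟨h1, h2 | h2⟩
    · exact .inr ⟨h1, h2⟩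
    · exact .inl ⟨h2, mem_univ _⟩
  · intro p hp
    by_cases hpA : (r p).1 ∈ A
    · simpa [g, hpA] using hHS (show r p ∈ A ×ˢ univ from ⟨hpA, mem_univ _⟩)
    · simpa [g, hpA] using hfS (hr1 p hp).1
  · intro x hx
    have : r (x, 0) = (x, 0) := hr2 _ ⟨hx, mem_univ _⟩ (.inl rfl)
    by_cases hxA : x ∈ A
    · simp [g, this, hxA, h0]
    · simp [g, this, hxA]
  · intro p hp
    have : r p = p := hr2 _ ⟨hAB hp.1, mem_univ _⟩ (.inr hp.1)
    simp [g, this, hp.1]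

/-- The retraction for `(B, A)` is itself a homotopy on `B`. Extending it over `D`, with values
confined to `D × {0} ∪ A × I`, gives the retraction for `(D, A)`. -/
theorem IsCofib.trans {A B D : Set X} (h₁ : IsCofib A B) (h₂ : IsCofib B D) (hAB : A ⊆ B)
    (hBD : B ⊆ D) (hB : IsClosed B) (hD : IsClosed D) : IsCofib A D := by
  obtain ⟨r, hr, hr1, hr2⟩ := h₁
  obtain ⟨G, hG, hGS, hG0, hG1⟩ := h₂.exists_extension hBD hB hD
    (f := fun x => (x, (0 : I))) (H := r) (by fun_prop) hr
    (fun x hx => hr2 _ ⟨hx, mem_univ _⟩ (.inl rfl))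
    (S := {p | p.1 ∈ D ∧ (p.2 = 0 ∨ p.1 ∈ A)}) (fun x hx => ⟨hx, .inl rfl⟩)
    (fun p hp => ⟨hBD (hr1 p hp).1, (hr1 p hp).2⟩)
  refine ⟨G, hG, hGS, ?_⟩
  rintro ⟨x, t⟩ hp (h | h)
  · obtain rfl : t = 0 := h
    exact hG0 x hp.1
  · have hxB : (x, t) ∈ B ×ˢ (univ : Set I) := ⟨hAB h, mem_univ _⟩
    rw [hG1 _ hxB, hr2 _ hxB (.inr h)]

/-- The retraction over `C` is the identity over `A ∩ C`, so it glues with the identity over `A`. -/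
theorem IsCofib.union {A C : Set X} (h : IsCofib (A ∩ C) C) (hA : IsClosed A) (hC : IsClosed C) :
    IsCofib A (A ∪ C) := by
  classical
  obtain ⟨r, hr, hr1, hr2⟩ := h
  have hrA : ∀ p : X × I, p.1 ∈ A → p.1 ∈ C → r p = p := fun p h h' =>
    hr2 p ⟨h', mem_univ _⟩ (.inr ⟨h, h'⟩)
  refine ⟨fun p => if p.1 ∈ A then p else r p, ?_, ?_, ?_⟩
  · rw [union_prod]
    refine ContinuousOn.union_of_isClosed ?_ ?_ (hA.prod isClosed_univ) (hC.prod isClosed_univ)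
    · exact continuousOn_id.congr fun p hp => if_pos hp.1
    · refine hr.congr fun p hp => ?_
      by_cases hpA : p.1 ∈ A
      · simp [hpA, hrA p hpA hp.1]
      · simp [hpA]
  · rintro p ⟨hp, -⟩
    by_cases hpA : p.1 ∈ A
    · simp [hpA]
    · have := hr1 p ⟨hp.resolve_left hpA, mem_univ _⟩
      simp only [hpA, if_false]
      exact ⟨.inr this.1, this.2.imp_right And.left⟩
  · rintro p ⟨hp, -⟩ h
    by_cases hpA : p.1 ∈ A
    · simp [hpA]
    · simp only [hpA, if_false]
      exact hr2 p ⟨hp.resolve_left hpA, mem_univ _⟩ (h.imp_right fun h => absurd h hpA)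

/-- Cofibrations are transported along closed embeddings, given by a pair of inverse maps. -/
theorem IsCofib.image {A B : Set X} (h : IsCofib A B) {φ : X → Y} {ψ : Y → X} (hAB : A ⊆ B)
    (hφ : ContinuousOn φ B) (hψ : ContinuousOn ψ (φ '' B)) (hψφ : ∀ x ∈ B, ψ (φ x) = x) :
    IsCofib (φ '' A) (φ '' B) := by
  obtain ⟨r, hr, hr1, hr2⟩ := h
  have hm : ∀ p ∈ (φ '' B) ×ˢ (univ : Set I), (ψ p.1, p.2) ∈ B ×ˢ (univ : Set I) := by
    rintro ⟨_, t⟩ ⟨⟨x, hx, rfl⟩, -⟩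
    simpa [hψφ x hx] using hx
  have hc : ContinuousOn (fun p : Y × I => r (ψ p.1, p.2)) ((φ '' B) ×ˢ univ) :=
    hr.comp ((hψ.comp continuousOn_fst fun p hp => hp.1).prodMk continuousOn_snd) hm
  refine ⟨fun p => (φ (r (ψ p.1, p.2)).1, (r (ψ p.1, p.2)).2), ?_, ?_, ?_⟩
  · exact (hφ.comp hc.fst fun p hp => (hr1 _ (hm p hp)).1).prodMk hc.snd
  · intro p hp
    have := hr1 _ (hm p hp)
    exact ⟨mem_image_of_mem _ this.1, this.2.imp_right (mem_image_of_mem _)⟩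
  · rintro ⟨y, t⟩ ⟨hy, -⟩ h
    obtain ⟨x, hx, rfl⟩ := hy
    have : r (x, t) = (x, t) := by
      refine hr2 _ ⟨hx, mem_univ _⟩ (h.imp_right ?_)
      rintro ⟨x', hx', e⟩
      have : x' = x := by rw [← hψφ x' (hAB hx'), ← hψφ x hx]; exact congrArg ψ e
      exact this ▸ hx'
    simp [hψφ x hx, this]

/-- The closed unit ball has the homotopy extension property relative to the unit sphere. -/
theorem isCofib_sphere_closedBall (E : Type*) [NormedAddCommGroup E] [NormedSpace ℝ E] :
    IsCofib (sphere (0 : E) 1) (closedBall 0 1) := by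
  -- Radial projection of the cylinder from the point `(0, 2)`: the ray through `(x, t)` meets the
  -- side or the bottom at parameter `1 / m`. On the cylinder `projIcc` below changes nothing and
  -- only supplies membership in `I`.
  let m : E × I → ℝ := fun p => max ‖p.1‖ (1 - p.2 / 2)
  have hm : ∀ p, 1 / 2 ≤ m p := fun p => le_max_of_le_right (by linarith [p.2.2.2])
  have hm0 : ∀ p, m p ≠ 0 := fun p => by linarith [hm p]
  have hmc : Continuous m := by fun_prop
  refine ⟨fun p => ((m p)⁻¹ • p.1, projIcc 0 1 zero_le_one (2 - (2 - p.2) / m p)), ?_, ?_, ?_⟩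
  · apply Continuous.continuousOn
    refine ((hmc.inv₀ hm0).smul continuous_fst).prodMk (continuous_projIcc.comp ?_)
    exact continuous_const.sub
      ((continuous_const.sub (continuous_subtype_val.comp continuous_snd)).div hmc hm0)
  · rintro p -
    have hmp : 0 < m p := by linarith [hm p]
    have hn : ‖(m p)⁻¹ • p.1‖ = ‖p.1‖ / m p := by
      rw [norm_smul, norm_inv, Real.norm_of_nonneg hmp.le, inv_mul_eq_div]
    refine ⟨?_, ?_⟩
    · rw [mem_closedBall_zero_iff, hn]
      exact (div_le_one hmp).2 (le_max_left _ _)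
    · rcases le_total ‖p.1‖ (1 - p.2 / 2) with h | h
      · left
        have : m p = 1 - p.2 / 2 := max_eq_right h
        have h2 : (2 - (p.2 : ℝ)) / m p = 2 := by
          rw [div_eq_iff (hm0 p), this]; ring
        simp [h2]
      · right
        have : m p = ‖p.1‖ := max_eq_left h
        rw [mem_sphere_zero_iff_norm, hn, ← this, div_self (hm0 p)]
  · rintro ⟨x, t⟩ ⟨hx, -⟩ h
    rw [mem_closedBall_zero_iff] at hx
    have : m (x, t) = 1 := by
      rcases h with h | h
      · obtain rfl : t = 0 := h
        simp [m, hx]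
      · simp only [mem_sphere_zero_iff_norm] at h
        simp only [m, h]
        exact max_eq_left (by linarith [t.2.1])
    simp [this]

end Cofibration

/-! ### Contractible subsets and their unions -/

section Contractible

variable {X Y : Type*} [TopologicalSpace X] [TopologicalSpace Y]

/-- The subset `A` is contractible within itself. -/
def ContractsIn (A : Set X) : Prop :=
  ∃ a ∈ A, ∃ h : X × I → X, ContinuousOn h (A ×ˢ univ) ∧ MapsTo h (A ×ˢ univ) A ∧
    (∀ x ∈ A, h (x, 0) = x) ∧ ∀ x ∈ A, h (x, 1) = a

theorem ContractsIn.of_contractibleSpace {A : Set X} (h : ContractibleSpace A) :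
    ContractsIn A := by
  classical
  obtain ⟨a, ⟨F⟩⟩ := id_nullhomotopic A
  let g : X × I → X := fun p => if h : p.1 ∈ A then F (p.2, ⟨p.1, h⟩) else p.1
  have hg : ∀ x (hx : x ∈ A) (t : I), g (x, t) = F (t, ⟨x, hx⟩) := fun x hx t => by simp [g, hx]
  refine ⟨a, a.2, g, ?_, ?_, ?_, ?_⟩
  · rw [continuousOn_iff_continuous_domRestrict]
    have : (A ×ˢ (univ : Set I)).domRestrict g =
        fun p => (F (p.1.2, ⟨p.1.1, p.2.1⟩) : X) := by
      ext p
      exact hg _ p.2.1 _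
    rw [this]
    fun_prop
  · rintro ⟨x, t⟩ ⟨hx, -⟩
    rw [hg x hx]
    exact Subtype.coe_prop _
  · intro x hx
    simp [hg x hx]
  · intro x hx
    simp [hg x hx]

theorem exists_homotopy_concat {A : Set X} (hA : IsClosed A) {f g : X × I → Y} {S : Set Y}
    (hf : ContinuousOn f (A ×ˢ univ)) (hg : ContinuousOn g (A ×ˢ univ))
    (hfS : MapsTo f (A ×ˢ univ) S) (hgS : MapsTo g (A ×ˢ univ) S)
    (hfg : ∀ x ∈ A, f (x, 1) = g (x, 0)) :
    ∃ k : X × I → Y, ContinuousOn k (A ×ˢ univ) ∧ MapsTo k (A ×ˢ univ) S ∧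
      (∀ x ∈ A, k (x, 0) = f (x, 0)) ∧ ∀ x ∈ A, k (x, 1) = g (x, 1) := by
  classical
  let u : I → I := fun t => projIcc 0 1 zero_le_one (2 * (t : ℝ))
  let v : I → I := fun t => projIcc 0 1 zero_le_one (2 * (t : ℝ) - 1)
  have hu : Continuous u := continuous_projIcc.comp (by fun_prop)
  have hv : Continuous v := continuous_projIcc.comp (by fun_prop)
  let k : X × I → Y := fun p => if (p.2 : ℝ) ≤ 1 / 2 then f (p.1, u p.2) else g (p.1, v p.2)
  have hk1 : ∀ (x : X) (t : I), (t : ℝ) ≤ 1 / 2 → k (x, t) = f (x, u t) := fun x t h => if_pos h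
  have hk2 : ∀ x ∈ A, ∀ t : I, 1 / 2 ≤ (t : ℝ) → k (x, t) = g (x, v t) := by
    intro x hx t ht
    rcases ht.eq_or_lt with h | h
    · have h1 : u t = 1 := by simp [u, ← h]
      have h2 : v t = 0 := by simp [v, ← h]
      rw [hk1 x t h.ge, h1, h2, hfg x hx]
    · exact if_neg (not_le.2 h)
  refine ⟨k, ?_, ?_, ?_, ?_⟩
  · have : (A ×ˢ univ : Set (X × I)) =
        A ×ˢ {t : I | (t : ℝ) ≤ 1 / 2} ∪ A ×ˢ {t : I | 1 / 2 ≤ (t : ℝ)} := by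
      rw [← prod_union]
      congr 1
      ext t
      simp [le_total]
    rw [this]
    refine ContinuousOn.union_of_isClosed ?_ ?_
      (hA.prod (isClosed_le continuous_subtype_val continuous_const))
      (hA.prod (isClosed_le continuous_const continuous_subtype_val))
    · refine (hf.comp (f := fun p => (p.1, u p.2)) (by fun_prop)
        fun p hp => ⟨hp.1, mem_univ _⟩).congr ?_
      exact fun p hp => hk1 p.1 p.2 hp.2
    · refine (hg.comp (f := fun p => (p.1, v p.2)) (by fun_prop)
        fun p hp => ⟨hp.1, mem_univ _⟩).congr ?_
      exact fun p hp => hk2 p.1 hp.1 p.2 hp.2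
  · rintro ⟨x, t⟩ ⟨hx, -⟩
    rcases le_total (t : ℝ) (1 / 2) with h | h
    · rw [hk1 x t h]
      exact hfS ⟨hx, mem_univ _⟩
    · rw [hk2 x hx t h]
      exact hgS ⟨hx, mem_univ _⟩
  · intro x hx
    rw [hk1 x 0 (by simp)]
    simp [u]
  · intro x hx
    rw [hk2 x hx 1 (by norm_num)]
    norm_num [v]

/-- A union of two contractible closed sets along a contractible intersection is contractible,
provided the relevant pairs have the homotopy extension property. -/
theorem ContractsIn.union {T C : Set X} (hT : IsClosed T) (hC : IsClosed C)
    (hTc : ContractsIn T) (hCc : ContractsIn C) (hA : ContractsIn (T ∩ C))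
    (h₁ : IsCofib (T ∩ C) C) (h₂ : IsCofib C (T ∪ C)) : ContractsIn (T ∪ C) := by
  classical
  obtain ⟨t₀, ht₀, k, hk, hkT, hk0, hk1⟩ := hTc
  obtain ⟨c₀, hc₀, l, hl, hlC, hl0, hl1⟩ := hCc
  obtain ⟨a, ha, m, hm, hmA, hm0, hm1⟩ := hA
  -- a retraction of `C` onto `T ∩ C`
  obtain ⟨G, hG, hGA, hG0, hG1⟩ := h₁.exists_extension inter_subset_right (hT.inter hC) hC
    (f := fun _ => a) continuousOn_const (H := fun p => m (p.1, unitInterval.symm p.2))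
    (hm.comp (f := fun p : X × I => (p.1, unitInterval.symm p.2)) (by fun_prop)
      fun p hp => ⟨hp.1, mem_univ _⟩)
    (fun x hx => by simpa using hm1 x hx) (S := T ∩ C) (fun _ _ => ha)
    (fun p hp => hmA ⟨hp.1, mem_univ _⟩)
  have hGid : ∀ x ∈ T ∩ C, G (x, 1) = x := fun x hx => by
    rw [hG1 (x, 1) ⟨hx, mem_univ _⟩]; simpa using hm0 x hx
  let ρ : X → X := fun x => if x ∈ T then x else G (x, 1)
  have hρT : ∀ x ∈ T, ρ x = x := fun x hx => if_pos hx
  have hρC : ∀ x ∈ C, ρ x = G (x, 1) := fun x hx => by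
    by_cases h : x ∈ T
    · rw [hρT x h, hGid x ⟨h, hx⟩]
    · exact if_neg h
  have hρCA : ∀ x ∈ C, ρ x ∈ T ∩ C := fun x hx => by
    rw [hρC x hx]; exact hGA ⟨hx, mem_univ _⟩
  have hρc : ContinuousOn ρ (T ∪ C) := by
    refine ContinuousOn.union_of_isClosed (continuousOn_id.congr hρT) ?_ hT hC
    exact (hG.comp (f := fun x => (x, (1 : I))) (by fun_prop)
      fun x hx => ⟨hx, mem_univ _⟩).congr hρC
  have hρmT : MapsTo ρ (T ∪ C) T := by
    rintro x (hx | hx)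
    · rwa [hρT x hx]
    · exact (hρCA x hx).1
  -- a homotopy of `T ∪ C` contracting `C` to a point
  obtain ⟨H, hH, hHS, hH0, hH1⟩ := h₂.exists_extension subset_union_right hC (hT.union hC)
    (f := id) continuousOn_id hl hl0 (S := T ∪ C) (fun _ h => h)
    (fun p hp => .inr (hlC hp))
  have hHC : ∀ x ∈ C, H (x, 1) = c₀ := fun x hx => by
    rw [hH1 _ ⟨hx, mem_univ _⟩, hl1 x hx]
  -- The time-one map of `H` sends all of `C` to `c₀`, hence cannot tell `x` from `ρ x`. So `H` can
  -- be followed by `H₁ ∘ kₜ ∘ ρ`, which contracts within `T`, the domain of `k`, before applying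
  -- `H₁`.
  have hHρ : ∀ x ∈ T ∪ C, H (ρ x, 1) = H (x, 1) := by
    rintro x (hx | hx)
    · rw [hρT x hx]
    · rw [hHC x hx, hHC _ (hρCA x hx).2]
  have hkρ : MapsTo (fun p : X × I => k (ρ p.1, p.2)) ((T ∪ C) ×ˢ univ) T :=
    fun p hp => hkT ⟨hρmT hp.1, mem_univ _⟩
  obtain ⟨F, hF, hFS, hF0, hF1⟩ := exists_homotopy_concat (hT.union hC) (f := H)
    (g := fun p => H (k (ρ p.1, p.2), 1)) (S := T ∪ C) hH
    (by
      refine hH.comp (f := fun p : X × I => (k (ρ p.1, p.2), (1 : I))) ?_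
        fun p hp => ⟨.inl (hkρ hp), mem_univ _⟩
      refine ContinuousOn.prodMk ?_ continuousOn_const
      exact hk.comp (f := fun p : X × I => (ρ p.1, p.2))
        ((hρc.comp continuousOn_fst fun p hp => hp.1).prodMk continuousOn_snd)
        fun p hp => ⟨hρmT hp.1, mem_univ _⟩)
    hHS (fun p hp => hHS ⟨.inl (hkρ hp), mem_univ _⟩)
    (fun x hx => by
      change H (x, 1) = H (k (ρ x, 0), 1)
      rw [hk0 _ (hρmT hx), hHρ x hx])
  refine ⟨H (t₀, 1), hHS ⟨.inl ht₀, mem_univ _⟩, F, hF, hFS, ?_, ?_⟩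
  · intro x hx
    rw [hF0 x hx, hH0 x hx, id]
  · intro x hx
    rw [hF1 x hx]
    change H (k (ρ x, 1), 1) = _
    rw [hk1 _ (hρmT hx)]

end Contractible

open Topology Topology.RelCWComplex

/-! ### Cells and subcomplexes of a regular complex -/

section Subcomplex

variable {X : Type*} [TopologicalSpace X] {K : Set X} [CWComplex K]

/-- The open cell. -/
abbrev innerCell (c : Cell K) : Set X := openCell c.1 c.2

theorem eq_of_mem_innerCell {c d : Cell K} {x : X} (hc : x ∈ innerCell c)
    (hd : x ∈ innerCell d) : c = d :=
  eq_of_not_disjoint_openCell (not_disjoint_iff.2 ⟨x, hc, hd⟩)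

theorem exists_mem_innerCell {x : X} (hx : x ∈ K) : ∃ c : Cell K, x ∈ innerCell c := by
  rw [← CWComplex.iUnion_openCell_eq_complex (C := K)] at hx
  simp only [mem_iUnion] at hx
  obtain ⟨n, i, h⟩ := hx
  exact ⟨⟨n, i⟩, h⟩

theorem exists_mem_innerCell_of_mem_boundary {c : Cell K} {x : X} (hx : x ∈ boundary c) :
    ∃ d : Cell K, d.1 < c.1 ∧ x ∈ innerCell d := by
  obtain ⟨J, hJ⟩ := CWComplex.cellFrontier_subset_finite_openCell c.1 c.2
  have := hJ hx
  simp only [mem_iUnion] at this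
  obtain ⟨m, hm, j, -, h⟩ := this
  exact ⟨⟨m, j⟩, hm, h⟩

theorem boundary_union_innerCell (c : Cell K) : boundary c ∪ innerCell c = closedCell c :=
  cellFrontier_union_openCell_eq_closedCell c.1 c.2

theorem innerCell_subset_closedCell (c : Cell K) : innerCell c ⊆ closedCell c :=
  openCell_subset_closedCell c.1 c.2

theorem boundary_subset_closedCell (c : Cell K) : boundary c ⊆ closedCell c :=
  cellFrontier_subset_closedCell c.1 c.2

theorem closedCell_subset_complex' (c : Cell K) : closedCell c ⊆ K :=
  closedCell_subset_complex c.1 c.2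

theorem innerCell_nonempty (c : Cell K) : (innerCell c).Nonempty :=
  openCell_nonempty c.1 c.2

theorem notMem_innerCell_of_mem_boundary {c : Cell K} {x : X} (hx : x ∈ boundary c) :
    x ∉ innerCell c := by
  intro h
  obtain ⟨d, hd, hxd⟩ := exists_mem_innerCell_of_mem_boundary hx
  exact hd.ne (congrArg Sigma.fst (eq_of_mem_innerCell hxd h))

theorem eq_or_dim_lt {c d : Cell K} {x : X} (hc : x ∈ innerCell c) (hd : x ∈ closedCell d) :
    c = d ∨ c.1 < d.1 := by
  rw [← boundary_union_innerCell] at hd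
  rcases hd with hd | hd
  · obtain ⟨b, hb, hxb⟩ := exists_mem_innerCell_of_mem_boundary hd
    rw [eq_of_mem_innerCell hc hxb]
    exact .inr hb
  · exact .inl (eq_of_mem_innerCell hc hd)

theorem exists_isMaximalCell [RelCWComplex.Finite K] (c : Cell K) :
    ∃ d : Cell K, IsMaximalCell d ∧ closedCell c ⊆ closedCell d := by
  have := finite_cells_of_finite (C := K)
  obtain ⟨d, hd, hmax⟩ := Set.exists_max_image {d : Cell K | closedCell c ⊆ closedCell d}
    Sigma.fst (Set.toFinite _) ⟨c, Subset.refl _⟩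
  refine ⟨d, fun b hb => ?_, hd⟩
  obtain ⟨x, hx⟩ := innerCell_nonempty d
  rcases eq_or_dim_lt hx (hb (innerCell_subset_closedCell d hx)) with h | h
  · exact h.symm
  · exact absurd (hmax b (subset_trans hd hb)) (not_le.2 h)

/-- A subset of a CW complex which contains the closed cell of each open cell that it meets. -/
def IsSubcomplex (K : Set X) [CWComplex K] (A : Set X) : Prop :=
  A ⊆ K ∧ ∀ c : Cell K, ∀ x ∈ innerCell c, x ∈ A → closedCell c ⊆ A

theorem IsSubcomplex.union {A B : Set X} (hA : IsSubcomplex K A) (hB : IsSubcomplex K B) :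
    IsSubcomplex K (A ∪ B) := by
  refine ⟨union_subset hA.1 hB.1, ?_⟩
  rintro c x hx (h | h)
  · exact (hA.2 c x hx h).trans subset_union_left
  · exact (hB.2 c x hx h).trans subset_union_right

theorem IsSubcomplex.inter {A B : Set X} (hA : IsSubcomplex K A) (hB : IsSubcomplex K B) :
    IsSubcomplex K (A ∩ B) :=
  ⟨inter_subset_left.trans hA.1, fun c x hx h =>
    subset_inter (hA.2 c x hx h.1) (hB.2 c x hx h.2)⟩

theorem isSubcomplex_self : IsSubcomplex K K :=
  ⟨subset_rfl, fun c _ _ _ => closedCell_subset_complex' c⟩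

theorem IsSubcomplex.isClosed [T2Space X] [RelCWComplex.Finite K] {A : Set X}
    (hA : IsSubcomplex K A) : IsClosed A := by
  have := finite_cells_of_finite (C := K)
  have : A = ⋃ c : {c : Cell K // closedCell c ⊆ A}, closedCell c.1 := by
    refine subset_antisymm (fun x hx => ?_) (iUnion_subset fun c => c.2)
    obtain ⟨c, hc⟩ := exists_mem_innerCell (hA.1 hx)
    exact mem_iUnion.2 ⟨⟨c, hA.2 c x hc hx⟩, innerCell_subset_closedCell c hc⟩
  rw [this]
  exact isClosed_iUnion_of_finite fun c => isClosed_closedCell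

/-- Induction on dimension: the boundary is a union of closed cells, each of smaller dimension
because its open cell meets an open cell of smaller dimension and must equal it. -/
theorem IsRegular.isSubcomplex_closedCell (hreg : IsRegular K) (c : Cell K) :
    IsSubcomplex K (closedCell c) := by
  refine ⟨closedCell_subset_complex' c, ?_⟩
  induction hn : c.1 using Nat.strong_induction_on generalizing c with
  | _ n ih =>
    subst hn
    intro b x hb hx
    rw [← boundary_union_innerCell] at hx
    rcases hx with hx | hx
    · obtain ⟨S, hS⟩ := hreg.boundary_eq c
      have hSc : ∀ d ∈ S, closedCell d ⊆ boundary c := fun d hd => by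
        rw [hS]; exact subset_biUnion_of_mem (u := closedCell) hd
      rw [hS] at hx
      simp only [mem_iUnion] at hx
      obtain ⟨d, hd, hx⟩ := hx
      have hlt : d.1 < c.1 := by
        obtain ⟨y, hy⟩ := innerCell_nonempty d
        obtain ⟨b', hb', hyb'⟩ := exists_mem_innerCell_of_mem_boundary
          (hSc d hd (innerCell_subset_closedCell d hy))
        rwa [eq_of_mem_innerCell hy hyb']
      exact (ih d.1 hlt d rfl b x hb hx).trans ((hSc d hd).trans (boundary_subset_closedCell c))
    · rw [eq_of_mem_innerCell hb hx]

/-- A closed cell of a regular complex has a chart that inverts the characteristic map. -/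
theorem IsRegular.exists_chart [T2Space X] (hreg : IsRegular K) (c : Cell K) :
    ∃ g : X → (Fin c.1 → ℝ), ContinuousOn g (closedCell c) ∧
      ∀ x ∈ closedBall (0 : Fin c.1 → ℝ) 1, g (map c.1 c.2 x) = x := by
  classical
  have hinj := hreg.injOn c
  refine ⟨Function.invFunOn (map c.1 c.2) (closedBall 0 1), ?_,
    fun x hx => hinj.leftInvOn_invFunOn hx⟩
  -- The inverse of an injective continuous map from a compact ball to a Hausdorff space is
  -- continuous: preimages of closed sets under it are compact images.
  rw [continuousOn_iff_isClosed]
  intro t ht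
  refine ⟨map c.1 c.2 '' (closedBall 0 1 ∩ t), ?_, ?_⟩
  · exact (((isCompact_closedBall 0 1).inter_right ht).image_of_continuousOn
      ((RelCWComplex.continuousOn c.1 c.2).mono inter_subset_left)).isClosed
  · ext y
    constructor
    · rintro ⟨hy, x, hx, rfl⟩
      refine ⟨⟨x, ⟨hx, ?_⟩, rfl⟩, mem_image_of_mem _ hx⟩
      rwa [mem_preimage, hinj.leftInvOn_invFunOn hx] at hy
    · rintro ⟨⟨x, ⟨hx, hxt⟩, rfl⟩, -⟩
      refine ⟨?_, mem_image_of_mem _ hx⟩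
      rwa [mem_preimage, hinj.leftInvOn_invFunOn hx]

theorem IsRegular.isCofib_boundary [T2Space X] (hreg : IsRegular K) (c : Cell K) :
    IsCofib (boundary c) (closedCell c) := by
  obtain ⟨g, hg, hgm⟩ := hreg.exists_chart c
  exact (isCofib_sphere_closedBall (Fin c.1 → ℝ)).image sphere_subset_closedBall
    (RelCWComplex.continuousOn c.1 c.2) hg hgm

theorem IsRegular.contractsIn_closedCell [T2Space X] (hreg : IsRegular K) (c : Cell K) :
    ContractsIn (closedCell c) := by
  obtain ⟨g, hg, hgm⟩ := hreg.exists_chart c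
  have hgB : ∀ y ∈ closedCell c, g y ∈ closedBall (0 : Fin c.1 → ℝ) 1 := by
    rintro _ ⟨x, hx, rfl⟩
    rwa [hgm x hx]
  have hs : ∀ p ∈ closedCell c ×ˢ (univ : Set I),
      (1 - p.2 : ℝ) • g p.1 ∈ closedBall (0 : Fin c.1 → ℝ) 1 := by
    rintro ⟨y, t⟩ ⟨hy, -⟩
    have := hgB y hy
    rw [mem_closedBall_zero_iff] at this ⊢
    rw [norm_smul, Real.norm_of_nonneg (by linarith [t.2.2])]
    exact mul_le_one₀ (by linarith [t.2.1]) (norm_nonneg _) this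
  refine ⟨map c.1 c.2 0, map_zero_mem_closedCell c.1 c.2,
    fun p => map c.1 c.2 ((1 - p.2 : ℝ) • g p.1), ?_, ?_, ?_, ?_⟩
  · refine (RelCWComplex.continuousOn c.1 c.2).comp ?_ hs
    refine ContinuousOn.smul (f := fun p : X × I => (1 - p.2 : ℝ)) (by fun_prop) ?_
    exact hg.comp (f := Prod.fst) continuousOn_fst fun p hp => hp.1
  · exact fun p hp => mem_image_of_mem _ (hs p hp)
  · rintro _ ⟨x, hx, rfl⟩
    simp [hgm x hx]
  · intro x _
    simp

/-- Pairs of subcomplexes have the homotopy extension property. -/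
theorem IsRegular.isCofib [T2Space X] [RelCWComplex.Finite K] (hreg : IsRegular K) {A B : Set X}
    (hA : IsSubcomplex K A) (hB : IsSubcomplex K B) (hAB : A ⊆ B) : IsCofib A B := by
  -- Induction on the number of cells of `B` missing from `A`. A missing cell of least dimension has
  -- its boundary in `A`, so it can be adjoined to `A` by the ball-sphere case.
  have hfin := finite_cells_of_finite (C := K)
  induction hn : {c : Cell K | closedCell c ⊆ B ∧ ¬ closedCell c ⊆ A}.ncard
    using Nat.strong_induction_on generalizing A with
  | _ n ih =>
    rcases eq_empty_or_nonempty {c : Cell K | closedCell c ⊆ B ∧ ¬ closedCell c ⊆ A} with h | h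
    · have : A = B := by
        refine hAB.antisymm fun x hx => ?_
        obtain ⟨c, hc⟩ := exists_mem_innerCell (hB.1 hx)
        by_contra hxA
        have : c ∈ (∅ : Set (Cell K)) := h ▸ ⟨hB.2 c x hc hx, fun h' =>
          hxA (h' (innerCell_subset_closedCell c hc))⟩
        exact this
      rw [this]
      exact IsCofib.refl B
    · obtain ⟨c, ⟨hcB, hcA⟩, hmin⟩ := Set.exists_min_image _ Sigma.fst (Set.toFinite _) h
      have hdisj : ∀ x ∈ innerCell c, x ∉ A := fun x hx hxA => hcA (hA.2 c x hx hxA)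
      have hbd : boundary c ⊆ A := by
        intro x hx
        obtain ⟨d, hd, hxd⟩ := exists_mem_innerCell_of_mem_boundary hx
        by_contra hxA
        refine absurd (hmin d ⟨hB.2 d x hxd (hcB (boundary_subset_closedCell c hx)), fun h' =>
          hxA (h' (innerCell_subset_closedCell d hxd))⟩) (not_le.2 hd)
      have hinter : A ∩ closedCell c = boundary c := by
        refine subset_antisymm ?_ (subset_inter hbd (boundary_subset_closedCell c))
        rintro x ⟨hxA, hx⟩
        rw [← boundary_union_innerCell] at hx
        exact hx.resolve_right fun h => hdisj x h hxA
      have hA' := hA.union (hreg.isSubcomplex_closedCell c)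
      have h1 : IsCofib A (A ∪ closedCell c) := by
        apply IsCofib.union _ hA.isClosed isClosed_closedCell
        rw [hinter]
        exact hreg.isCofib_boundary c
      refine h1.trans (ih _ ?_ hA' (union_subset hAB hcB) rfl) subset_union_left
        (union_subset hAB hcB) hA'.isClosed hB.isClosed
      rw [← hn]
      refine Set.ncard_lt_ncard ⟨?_, fun h' => ?_⟩ (Set.toFinite _)
      · exact fun d hd => ⟨hd.1, fun h' => hd.2 (h'.trans subset_union_left)⟩
      · exact (h' ⟨hcB, hcA⟩).2 subset_union_right

end Subcomplex

/-! ### The trunk and its contractibility -/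

section Trunk

variable {X : Type*} [TopologicalSpace X] {K : Set X} [CWComplex K]

theorem mem_attachingSet {k : ℕ} {e : Fin k → Cell K} {j : Fin k} {x : X} :
    x ∈ attachingSet e j ↔ (∃ i < j, x ∈ closedCell (e i)) ∧ x ∈ closedCell (e j) := by
  simp [attachingSet]

/-- The closed cell `d` is a subcomplex, so meeting the open cell of `c` forces it to contain the
closed cell of `c`. -/
theorem IsRegular.eq_of_isMaximalCell (hreg : IsRegular K) {c d : Cell K} (hc : IsMaximalCell c)
    {x : X} (hx : x ∈ innerCell c) (hd : x ∈ closedCell d) : d = c :=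
  hc d ((hreg.isSubcomplex_closedCell d).2 c x hx hd)

/-- The union of the first `m` cells of a list, without the open cells that are attached along
their whole boundary. -/
def trunk {k : ℕ} (e : Fin k → Cell K) (m : ℕ) : Set X :=
  {x | (∃ i : Fin k, (i : ℕ) < m ∧ x ∈ closedCell (e i)) ∧
    ∀ j : SphereIndex e, x ∉ innerCell (e j.1)}

variable {k : ℕ} {e : Fin k → Cell K}

theorem IsTopologicalShelling.isMaximalCell (he : IsTopologicalShelling e) (j : Fin k) :
    IsMaximalCell (e j) :=
  (he.mem_range_iff _).1 ⟨j, rfl⟩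

theorem isSubcomplex_trunk (hreg : IsRegular K) (he : IsTopologicalShelling e) (m : ℕ) :
    IsSubcomplex K (trunk e m) := by
  refine ⟨fun x ⟨⟨i, _, hx⟩, _⟩ => closedCell_subset_complex' _ hx, ?_⟩
  rintro c x hxc ⟨⟨i, him, hxi⟩, hx⟩ y hy
  refine ⟨⟨i, him, (hreg.isSubcomplex_closedCell _).2 c x hxc hxi hy⟩, fun j hyj => ?_⟩
  have := hreg.eq_of_isMaximalCell (he.isMaximalCell j.1) hyj hy
  exact hx j (this ▸ hxc)

theorem IsTopologicalShelling.exists_mem_closedCell [RelCWComplex.Finite K]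
    (he : IsTopologicalShelling e) {x : X} (hx : x ∈ K) : ∃ i, x ∈ closedCell (e i) := by
  obtain ⟨c, hc⟩ := exists_mem_innerCell hx
  obtain ⟨d, hd, hcd⟩ := exists_isMaximalCell c
  obtain ⟨i, rfl⟩ := (he.mem_range_iff d).2 hd
  exact ⟨i, hcd (innerCell_subset_closedCell c hc)⟩

theorem mem_trunk_iff [RelCWComplex.Finite K] (he : IsTopologicalShelling e) {x : X} :
    x ∈ trunk e k ↔ x ∈ K ∧ ∀ j : SphereIndex e, x ∉ innerCell (e j.1) := by
  refine ⟨fun ⟨⟨i, _, hx⟩, h⟩ => ⟨closedCell_subset_complex' _ hx, h⟩, fun ⟨hx, h⟩ => ⟨?_, h⟩⟩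
  obtain ⟨i, hi⟩ := he.exists_mem_closedCell hx
  exact ⟨i, i.2, hi⟩

theorem trunk_succ_of_eq {j : Fin k} (h0 : 0 < (j : ℕ)) (hj : attachingSet e j = boundary (e j)) :
    trunk e (j + 1) = trunk e j := by
  ext x
  constructor
  · rintro ⟨⟨i, hi, hx⟩, h⟩
    refine ⟨?_, h⟩
    rcases (Nat.lt_succ_iff.1 hi).lt_or_eq with hlt | heq
    · exact ⟨i, hlt, hx⟩
    · obtain rfl := Fin.ext heq
      rw [← boundary_union_innerCell] at hx
      have := hx.resolve_right (h ⟨i, h0, hj⟩)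
      rw [← hj, mem_attachingSet] at this
      exact this.1
  · rintro ⟨⟨i, hi, hx⟩, h⟩
    exact ⟨⟨i, hi.trans (Nat.lt_succ_self _), hx⟩, h⟩

/-- A cell of the list that is not attached along its whole boundary lies in the trunk. -/
theorem IsTopologicalShelling.notMem_innerCell (hreg : IsRegular K)
    (he : IsTopologicalShelling e) {j : Fin k}
    (hj : ¬ (0 < (j : ℕ) ∧ attachingSet e j = boundary (e j))) {x : X}
    (hx : x ∈ closedCell (e j)) (i : SphereIndex e) : x ∉ innerCell (e i.1) := fun hxi => by
  have := he.injective (hreg.eq_of_isMaximalCell (he.isMaximalCell i.1) hxi hx)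
  exact hj (this ▸ i.2)

theorem trunk_succ (hreg : IsRegular K) (he : IsTopologicalShelling e) {j : Fin k}
    (hj : ¬ (0 < (j : ℕ) ∧ attachingSet e j = boundary (e j))) :
    trunk e (j + 1) = trunk e j ∪ closedCell (e j) := by
  ext x
  constructor
  · rintro ⟨⟨i, hi, hx⟩, h⟩
    rcases (Nat.lt_succ_iff.1 hi).lt_or_eq with hlt | heq
    · exact .inl ⟨⟨i, hlt, hx⟩, h⟩
    · obtain rfl := Fin.ext heq
      exact .inr hx
  · rintro (⟨⟨i, hi, hx⟩, h⟩ | hx)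
    · exact ⟨⟨i, hi.trans (Nat.lt_succ_self _), hx⟩, h⟩
    · exact ⟨⟨j, Nat.lt_succ_self _, hx⟩, he.notMem_innerCell hreg hj hx⟩

/-- Deleting open cells loses nothing here: the closed cell of `e j` misses all of them. -/
theorem trunk_inter (hreg : IsRegular K) (he : IsTopologicalShelling e) {j : Fin k}
    (hj : ¬ (0 < (j : ℕ) ∧ attachingSet e j = boundary (e j))) :
    trunk e j ∩ closedCell (e j) = attachingSet e j := by
  ext x
  rw [mem_attachingSet]
  constructor
  · rintro ⟨⟨h, -⟩, hx⟩
    exact ⟨h, hx⟩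
  · rintro ⟨h, hx⟩
    exact ⟨⟨h, he.notMem_innerCell hreg hj hx⟩, hx⟩

theorem contractsIn_trunk [T2Space X] [RelCWComplex.Finite K] (hreg : IsRegular K)
    (he : IsTopologicalShelling e) {m : ℕ} (h0 : 0 < m) (hm : m ≤ k) :
    ContractsIn (trunk e m) := by
  induction m, h0 using Nat.le_induction with
  | base =>
    -- The first cell is never deleted, even if its boundary is empty, so the trunk starts as a
    -- closed ball.
    have hj : ¬ (0 < ((⟨0, hm⟩ : Fin k) : ℕ) ∧
        attachingSet e ⟨0, hm⟩ = boundary (e ⟨0, hm⟩)) := fun h => h.1.false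
    have := trunk_succ hreg he hj
    have h0 : trunk e 0 = ∅ := by
      ext x
      simp [trunk]
    simp only [h0, empty_union] at this
    exact this ▸ hreg.contractsIn_closedCell _
  | succ m h0 ih =>
    have ih := ih (Nat.le_of_succ_le hm)
    let j : Fin k := ⟨m, hm⟩
    by_cases hj : attachingSet e j = boundary (e j)
    · have := trunk_succ_of_eq (j := j) h0 hj
      exact this ▸ ih
    · have hj' : ¬ (0 < (j : ℕ) ∧ attachingSet e j = boundary (e j)) := fun h => hj h.2
      have hA := ((he.attach j h0).resolve_right hj).2
      have hT := isSubcomplex_trunk hreg he j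
      have hC := hreg.isSubcomplex_closedCell (e j)
      have := trunk_succ hreg he hj'
      rw [show m + 1 = (j : ℕ) + 1 from rfl, this]
      refine ContractsIn.union hT.isClosed isClosed_closedCell ih
        (hreg.contractsIn_closedCell _) ?_
        (hreg.isCofib (hT.inter hC) hC inter_subset_right)
        (hreg.isCofib hC (hT.union hC) subset_union_right)
      rw [trunk_inter hreg he hj']
      exact ContractsIn.of_contractibleSpace hA

end Trunk

/-! ### Wedges of pointed spaces -/

section Wedge

variable {ι : Type*} {X : ι → Type*} {p : ∀ i, X i}

/-- The map from the wedge to the product of the pointed spaces. -/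
noncomputable def Wedge.toPi [DecidableEq ι] : Wedge X p → ∀ i, X i :=
  Quot.lift (Sum.elim (fun _ => p) fun s => Function.update p s.1 s.2) (by
    rintro _ _ ⟨i⟩
    simp)

/-- The common base point of a wedge. -/
def Wedge.base : Wedge X p := Quot.mk _ (Sum.inl PUnit.unit)

/-- The inclusion of a summand into the wedge. -/
def Wedge.inc (i : ι) (x : X i) : Wedge X p := Quot.mk _ (Sum.inr ⟨i, x⟩)

theorem Wedge.inc_base (i : ι) : Wedge.inc i (p i) = (Wedge.base : Wedge X p) :=
  (Quot.sound (WedgeRel.glue i)).symm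

theorem Wedge.eq_base_or_inc (w : Wedge X p) : w = Wedge.base ∨ ∃ i x, w = Wedge.inc i x := by
  obtain ⟨⟨⟩ | ⟨i, x⟩, rfl⟩ := Quot.exists_rep w
  · exact .inl rfl
  · exact .inr ⟨i, x, rfl⟩

theorem Wedge.toPi_base [DecidableEq ι] : (Wedge.base : Wedge X p).toPi = p := rfl

theorem Wedge.toPi_inc [DecidableEq ι] (i : ι) (x : X i) :
    (Wedge.inc i x : Wedge X p).toPi = Function.update p i x := rfl

theorem Wedge.inc_eq_base_iff {i : ι} {x : X i} :
    (Wedge.inc i x : Wedge X p) = Wedge.base ↔ x = p i := by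
  classical
  refine ⟨fun h => ?_, fun h => h ▸ Wedge.inc_base i⟩
  have := congrFun (congrArg Wedge.toPi h) i
  simpa [Wedge.toPi_base, Wedge.toPi_inc] using this

theorem Wedge.inc_injective (i : ι) : Function.Injective (Wedge.inc i : X i → Wedge X p) := by
  classical
  intro x y h
  have := congrFun (congrArg Wedge.toPi h) i
  simpa [Wedge.toPi_inc] using this

theorem Wedge.eq_base_of_inc_eq_inc {i j : ι} (hij : i ≠ j) {x : X i} {y : X j}
    (h : (Wedge.inc i x : Wedge X p) = Wedge.inc j y) : x = p i := by
  classical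
  have := congrFun (congrArg Wedge.toPi h) i
  simpa [Wedge.toPi_inc, hij] using this

/-- Makes a wedge of Hausdorff spaces Hausdorff, since the map to the product is also continuous. -/
theorem Wedge.toPi_injective [DecidableEq ι] :
    Function.Injective (Wedge.toPi : Wedge X p → ∀ i, X i) := by
  intro v w h
  rcases Wedge.eq_base_or_inc v with rfl | ⟨i, x, rfl⟩ <;>
    rcases Wedge.eq_base_or_inc w with rfl | ⟨j, y, rfl⟩
  · rfl
  · have := congrFun h j
    simp only [Wedge.toPi_base, Wedge.toPi_inc, Function.update_self] at this
    exact (Wedge.inc_eq_base_iff.2 this.symm).symm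
  · have := congrFun h i
    simp only [Wedge.toPi_base, Wedge.toPi_inc, Function.update_self] at this
    exact Wedge.inc_eq_base_iff.2 this
  · have hi := congrFun h i
    have hj := congrFun h j
    simp only [Wedge.toPi_inc] at hi hj
    by_cases hij : i = j
    · subst hij
      simp only [Function.update_self] at hi
      rw [hi]
    · rw [Function.update_self, Function.update_of_ne hij] at hi
      rw [Function.update_self, Function.update_of_ne (Ne.symm hij)] at hj
      rw [hi, ← hj, Wedge.inc_base, Wedge.inc_base]

variable [∀ i, TopologicalSpace (X i)]

theorem Wedge.continuous_inc (i : ι) : Continuous (Wedge.inc i : X i → Wedge X p) :=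
  continuous_quot_mk.comp (continuous_inr.comp continuous_sigmaMk)

theorem Wedge.continuous_toPi [DecidableEq ι] :
    Continuous (Wedge.toPi : Wedge X p → ∀ i, X i) := by
  refine continuous_quot_lift _ (Continuous.sumElim continuous_const ?_)
  exact continuous_sigma fun i => continuous_const.update i continuous_id

instance Wedge.t2Space [∀ i, T2Space (X i)] : T2Space (Wedge X p) := by
  classical
  exact T2Space.of_injective_continuous Wedge.toPi_injective Wedge.continuous_toPi

end Wedge

/-! ### Collapsing the boundary of a cube to get a sphere -/

section Collapse

variable {n : ℕ}

theorem mem_sphere_iff_sum {w : EuclideanSpace ℝ (Fin (n + 1))} :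
    w ∈ sphere (0 : EuclideanSpace ℝ (Fin (n + 1))) 1 ↔
      w 0 ^ 2 + ∑ i : Fin n, w i.succ ^ 2 = 1 := by
  rw [mem_sphere_zero_iff_norm, EuclideanSpace.norm_eq, Real.sqrt_eq_one, Fin.sum_univ_succ]
  simp

theorem collapse_denom_pos (x : Fin n → ℝ) : 0 < ∑ i, x i ^ 2 + (1 - ‖x‖) ^ 2 := by
  have hq : 0 ≤ ∑ i, x i ^ 2 := Finset.sum_nonneg fun i _ => sq_nonneg _
  rcases eq_or_ne x 0 with rfl | hx
  · simp
  · obtain ⟨i, hi⟩ := Function.ne_iff.1 hx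
    have : 0 < ∑ i, x i ^ 2 :=
      Finset.sum_pos' (fun i _ => sq_nonneg _) ⟨i, Finset.mem_univ _, by
        have : x i ≠ 0 := hi
        positivity⟩
    positivity

/-- The map from the cube to the sphere that collapses the boundary of the cube to the base point:
radial rescaling of the open cube to Euclidean space followed by the inverse of stereographic
projection. -/
noncomputable def collapse (x : Fin n → ℝ) : Sphere n :=
  -- With `y = x / (1 - ‖x‖)`, this is `(|y|² - 1, 2y) / (|y|² + 1)` multiplied through by `(1 -
  -- ‖x‖)²`, so that it extends to `‖x‖ = 1`. Here `‖x‖` is the sup norm, while `|y|` is Euclidean.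
  ⟨WithLp.toLp 2 (Fin.cons
      ((∑ i, x i ^ 2 - (1 - ‖x‖) ^ 2) / (∑ i, x i ^ 2 + (1 - ‖x‖) ^ 2))
      fun i => 2 * (1 - ‖x‖) * x i / (∑ i, x i ^ 2 + (1 - ‖x‖) ^ 2)), by
    have hd := (collapse_denom_pos x).ne'
    rw [mem_sphere_iff_sum]
    simp only [Fin.cons_zero, Fin.cons_succ, div_pow, mul_pow, ← Finset.sum_div,
      ← Finset.mul_sum]
    rw [← add_div, div_eq_one_iff_eq (pow_ne_zero 2 hd)]
    ring⟩

theorem collapse_zero_coord (x : Fin n → ℝ) : (collapse x).1 0 =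
    (∑ i, x i ^ 2 - (1 - ‖x‖) ^ 2) / (∑ i, x i ^ 2 + (1 - ‖x‖) ^ 2) := rfl

theorem collapse_succ_coord (x : Fin n → ℝ) (i : Fin n) : (collapse x).1 i.succ =
    2 * (1 - ‖x‖) * x i / (∑ i, x i ^ 2 + (1 - ‖x‖) ^ 2) := rfl

theorem continuous_collapse : Continuous (collapse : (Fin n → ℝ) → Sphere n) := by
  refine Continuous.subtype_mk ((PiLp.continuous_toLp 2 _).comp (continuous_pi fun i => ?_)) _
  refine Fin.cases ?_ (fun i => ?_) i
  · simp only [Fin.cons_zero]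
    exact Continuous.div (by fun_prop) (by fun_prop) fun x => (collapse_denom_pos x).ne'
  · simp only [Fin.cons_succ]
    exact Continuous.div (by fun_prop) (by fun_prop) fun x => (collapse_denom_pos x).ne'

theorem eq_sphereBase_iff {w : Sphere n} : w = sphereBase n ↔ w.1 0 = 1 := by
  constructor
  · rintro rfl
    simp [sphereBase]
  · intro h
    have hw := mem_sphere_iff_sum.1 w.2
    rw [h, one_pow, add_eq_left, Finset.sum_eq_zero_iff_of_nonneg fun i _ => sq_nonneg _] at hw
    ext i
    refine Fin.cases ?_ (fun i => ?_) i
    · simpa [sphereBase] using h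
    · simpa [sphereBase] using hw i (Finset.mem_univ _)

theorem collapse_eq_sphereBase_iff {x : Fin n → ℝ} : collapse x = sphereBase n ↔ ‖x‖ = 1 := by
  rw [eq_sphereBase_iff, collapse_zero_coord, div_eq_one_iff_eq (collapse_denom_pos x).ne']
  constructor
  · intro h
    have : (1 - ‖x‖) ^ 2 = 0 := by linarith
    linarith [pow_eq_zero_iff (two_ne_zero) |>.1 this]
  · intro h
    simp [h]

/-- Stereographic projection from the base point recovers the rescaled vector, which gives
injectivity on the open cube. -/
theorem collapse_coord_div {x : Fin n → ℝ} (hx : ‖x‖ < 1) (i : Fin n) :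
    (collapse x).1 i.succ / (1 - (collapse x).1 0) = x i / (1 - ‖x‖) := by
  have hd := (collapse_denom_pos x).ne'
  have hs : 1 - ‖x‖ ≠ 0 := by linarith
  have h1 : 1 - (collapse x).1 0 = 2 * (1 - ‖x‖) ^ 2 / (∑ i, x i ^ 2 + (1 - ‖x‖) ^ 2) := by
    rw [collapse_zero_coord, eq_div_iff hd, sub_mul, div_mul_cancel₀ _ hd]
    ring
  rw [h1, collapse_succ_coord, div_div_div_cancel_right₀ hd]
  field_simp

theorem collapse_injOn : InjOn (collapse : (Fin n → ℝ) → Sphere n) (ball 0 1) := by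
  intro x hx y hy h
  rw [mem_ball_zero_iff] at hx hy
  have hxs : 0 < 1 - ‖x‖ := by linarith
  have hys : 0 < 1 - ‖y‖ := by linarith
  have hv : (1 - ‖x‖)⁻¹ • x = (1 - ‖y‖)⁻¹ • y := by
    ext i
    simp only [Pi.smul_apply, smul_eq_mul, inv_mul_eq_div]
    rw [← collapse_coord_div hx, ← collapse_coord_div hy, h]
  -- Since `t ↦ t / (1 - t)` is injective, the norms agree, hence so do the vectors.
  have hn := congrArg norm hv
  rw [norm_smul, norm_smul, norm_inv, norm_inv, Real.norm_of_nonneg hxs.le,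
    Real.norm_of_nonneg hys.le, inv_mul_eq_div, inv_mul_eq_div,
    div_eq_div_iff hxs.ne' hys.ne'] at hn
  have hxy : ‖x‖ = ‖y‖ := by linarith
  rw [hxy] at hv
  exact smul_right_injective _ (inv_ne_zero hys.ne') hv

theorem exists_collapse_eq {w : Sphere n} (hw : w ≠ sphereBase n) :
    ∃ x ∈ ball (0 : Fin n → ℝ) 1, collapse x = w := by
  have hw0 : w.1 0 ≠ 1 := fun h => hw (eq_sphereBase_iff.2 h)
  have hws := mem_sphere_iff_sum.1 w.2
  have hq : 0 ≤ ∑ i : Fin n, w.1 i.succ ^ 2 := Finset.sum_nonneg fun i _ => sq_nonneg _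
  have hlt : 0 < 1 - w.1 0 := by
    have : w.1 0 ≤ 1 := by nlinarith
    linarith [lt_of_le_of_ne this hw0]
  let y : Fin n → ℝ := fun i => w.1 i.succ / (1 - w.1 0)
  have hy : 0 < 1 + ‖y‖ := by positivity
  -- Chosen so that `1 - ‖s • y‖ = s`: rescaling `s • y` returns the stereographic coordinates `y`
  -- of `w`.
  let s : ℝ := (1 + ‖y‖)⁻¹
  have hs : 0 < s := inv_pos.2 hy
  have hn : ‖s • y‖ = 1 - s := by
    rw [norm_smul, Real.norm_of_nonneg hs.le]
    simp only [s]
    field_simp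
    ring
  have hyq : ∑ i, (s • y) i ^ 2 = s ^ 2 * ((1 + w.1 0) / (1 - w.1 0)) := by
    simp only [Pi.smul_apply, smul_eq_mul, mul_pow, ← Finset.mul_sum, y, div_pow,
      ← Finset.sum_div]
    congr 1
    rw [show ∑ i : Fin n, w.1 i.succ ^ 2 = (1 + w.1 0) * (1 - w.1 0) by linarith, sq,
      mul_div_mul_right _ _ hlt.ne']
  have hd : ∑ i, (s • y) i ^ 2 + (1 - ‖s • y‖) ^ 2 = 2 * s ^ 2 / (1 - w.1 0) := by
    rw [hyq, hn]
    field_simp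
    ring
  refine ⟨s • y, ?_, ?_⟩
  · rw [mem_ball_zero_iff, hn]
    linarith
  · ext i
    refine Fin.cases ?_ (fun i => ?_) i
    · rw [collapse_zero_coord, hd, hyq, hn]
      field_simp
      ring
    · rw [collapse_succ_coord, hd, hn]
      simp only [Pi.smul_apply, smul_eq_mul, y]
      field_simp
      ring

end Collapse

/-! ### Collapsing a contractible subset -/

section Quotient

variable {X W : Type*} [TopologicalSpace X] [CompactSpace X] [TopologicalSpace W] [T2Space W]

/-- A quotient map that collapses a subset `T` to a point is a homotopy equivalence, if some
homotopy of the identity, preserving `T`, contracts `T` to a point. -/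
theorem nonempty_homotopyEquiv_of_collapse (q : C(X, W)) (hq : Function.Surjective q) {T : Set X}
    (hT : ∀ x ∈ T, ∀ y ∈ T, q x = q y) (hqT : ∀ x y, q x = q y → x = y ∨ x ∈ T ∧ y ∈ T)
    (H : C(I × X, X)) (h0 : ∀ x, H (0, x) = x) (hHT : ∀ t, ∀ x ∈ T, H (t, x) ∈ T) {a : X}
    (h1 : ∀ x ∈ T, H (1, x) = a) : Nonempty (X ≃ₕ W) := by
  -- Compact source and Hausdorff target make `q` closed. The same argument applies to `id × q`, so
  -- homotopies descend as well.
  have hqm : IsQuotientMap q := q.continuous.isClosedMap.isQuotientMap q.continuous hq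
  let Q : C(I × X, I × W) := (ContinuousMap.id I).prodMap q
  have hQ : IsQuotientMap Q := Q.continuous.isClosedMap.isQuotientMap Q.continuous
    (Function.surjective_id.prodMap hq)
  -- Being constant on `T`, the end of the homotopy factors through `q`; this gives the homotopy
  -- inverse `ψ`. The homotopy itself descends after composing with `q`, because it preserves `T`.
  let H₁ : C(X, X) := H.comp ((ContinuousMap.const X 1).prodMk (ContinuousMap.id X))
  have hH₁ : Function.FactorsThrough H₁ q := by
    intro x y hxy
    rcases hqT x y hxy with rfl | ⟨hx, hy⟩
    · rfl
    · exact (h1 x hx).trans (h1 y hy).symm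
  let ψ : C(W, X) := hqm.lift H₁ hH₁
  have hψ : ∀ x, ψ (q x) = H (1, x) := fun x => DFunLike.congr_fun (hqm.lift_comp H₁ hH₁) x
  have hF : Function.FactorsThrough (q.comp H) Q := by
    rintro ⟨s, x⟩ ⟨t, y⟩ hxy
    obtain ⟨rfl, hq'⟩ : s = t ∧ q x = q y := Prod.ext_iff.1 hxy
    rcases hqT x y hq' with rfl | ⟨hx, hy⟩
    · rfl
    · exact hT _ (hHT s x hx) _ (hHT s y hy)
  let G : C(I × W, W) := hQ.lift (q.comp H) hF
  have hG : ∀ t x, G (t, q x) = q (H (t, x)) := fun t x =>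
    DFunLike.congr_fun (hQ.lift_comp (q.comp H) hF) (t, x)
  refine ⟨⟨q, ψ, ContinuousMap.Homotopic.symm ⟨⟨H, h0, fun x => (hψ x).symm⟩⟩,
    ContinuousMap.Homotopic.symm ⟨⟨G, fun w => ?_, fun w => ?_⟩⟩⟩⟩
  · obtain ⟨x, rfl⟩ := hq w
    exact (hG 0 x).trans (congrArg q (h0 x))
  · obtain ⟨x, rfl⟩ := hq w
    exact (hG 1 x).trans (congrArg q (hψ x).symm)

end Quotient

/-! ### The collapse of the trunk and the theorem -/

section Main

variable {X : Type*} [TopologicalSpace X] {K : Set X} [CWComplex K]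
  {k : ℕ} {e : Fin k → Cell K}

/-- The map from the complex to the wedge of spheres that collapses the trunk. -/
theorem exists_collapse_trunk [T2Space X] [RelCWComplex.Finite K] (hreg : IsRegular K)
    (he : IsTopologicalShelling e) (hne : (trunk e k).Nonempty) :
    ∃ q : C(K, Wedge (fun j : SphereIndex e => Sphere (e j.1).1)
        (fun j : SphereIndex e => sphereBase (e j.1).1)),
      Function.Surjective q ∧ (∀ x : K, x.1 ∈ trunk e k → q x = Wedge.base) ∧
      ∀ x y, q x = q y → x = y ∨ x.1 ∈ trunk e k ∧ y.1 ∈ trunk e k := by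
  classical
  choose g hg hgm using fun j : SphereIndex e => hreg.exists_chart (e j.1)
  let f : X → Wedge (fun j : SphereIndex e => Sphere (e j.1).1)
      (fun j : SphereIndex e => sphereBase (e j.1).1) := fun x =>
    if h : ∃ j : SphereIndex e, x ∈ innerCell (e j.1) then
      Wedge.inc h.choose (collapse (g h.choose x)) else Wedge.base
  have hfT : ∀ x ∈ trunk e k, f x = Wedge.base := fun x hx =>
    dif_neg fun ⟨j, hj⟩ => hx.2 j hj
  have hfI : ∀ (j : SphereIndex e), ∀ x ∈ innerCell (e j.1),
      f x = Wedge.inc j (collapse (g j x)) := by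
    intro j x hx
    have h : ∃ j : SphereIndex e, x ∈ innerCell (e j.1) := ⟨j, hx⟩
    have hj : h.choose = j :=
      Subtype.ext (he.injective (eq_of_mem_innerCell h.choose_spec hx))
    have : f x = Wedge.inc h.choose (collapse (g h.choose x)) := dif_pos h
    rw [this, hj]
  have hbT : ∀ (j : SphereIndex e), boundary (e j.1) ⊆ trunk e k := by
    intro j x hx
    refine (mem_trunk_iff he).2
      ⟨closedCell_subset_complex' _ (boundary_subset_closedCell _ hx), fun i hi => ?_⟩
    have := hreg.eq_of_isMaximalCell (he.isMaximalCell i.1) hi (boundary_subset_closedCell _ hx)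
    exact notMem_innerCell_of_mem_boundary hx (this ▸ hi)
  -- On the boundary both sides are the base point, so a single continuous formula serves the whole
  -- closed cell, and the closed pieces can be glued.
  have hfC : ∀ (j : SphereIndex e), ∀ x ∈ closedCell (e j.1),
      f x = Wedge.inc j (collapse (g j x)) := by
    intro j x hx
    rw [← boundary_union_innerCell] at hx
    rcases hx with hx | hx
    · rw [hfT x (hbT j hx), eq_comm, Wedge.inc_eq_base_iff, collapse_eq_sphereBase_iff]
      obtain ⟨y, hy, rfl⟩ := hx
      rw [hgm j y (sphere_subset_closedBall hy)]
      exact mem_sphere_zero_iff_norm.1 hy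
    · exact hfI j x hx
  have hcover : ∀ x ∈ K, x ∈ trunk e k ∨ ∃ j : SphereIndex e, x ∈ innerCell (e j.1) := by
    intro x hx
    by_cases h : ∃ j : SphereIndex e, x ∈ innerCell (e j.1)
    · exact .inr h
    · exact .inl ((mem_trunk_iff he).2 ⟨hx, fun j hj => h ⟨j, hj⟩⟩)
  have hfc : ContinuousOn f K := by
    have h1 : ContinuousOn f (⋃ j : SphereIndex e, closedCell (e j.1)) :=
      (locallyFinite_of_finite _).continuousOn_iUnion (fun j => isClosed_closedCell) fun j =>
        (((Wedge.continuous_inc j).comp continuous_collapse).comp_continuousOn (hg j)).congr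
          (hfC j)
    have h2 : ContinuousOn f (trunk e k) := continuousOn_const.congr hfT
    refine (h2.union_of_isClosed h1 (isSubcomplex_trunk hreg he k).isClosed
      (isClosed_iUnion_of_finite fun j => isClosed_closedCell)).mono fun x hx => ?_
    rcases hcover x hx with h | ⟨j, hj⟩
    · exact .inl h
    · exact .inr (mem_iUnion.2 ⟨j, innerCell_subset_closedCell _ hj⟩)
  have hfB : ∀ (j : SphereIndex e), ∀ x ∈ innerCell (e j.1),
      collapse (g j x) ≠ sphereBase _ := by
    rintro j _ ⟨y, hy, rfl⟩
    rw [hgm j y (ball_subset_closedBall hy), Ne, collapse_eq_sphereBase_iff]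
    exact (mem_ball_zero_iff.1 hy).ne
  refine ⟨⟨K.domRestrict f, hfc.domRestrict⟩, ?_, fun x hx => hfT x hx, ?_⟩
  · intro w
    -- The base point must come from the trunk: a deleted cell of dimension 0 has empty boundary and
    -- reaches only the other point of its sphere.
    have hbase : ∃ x : K, f x = Wedge.base := by
      obtain ⟨x, hx⟩ := hne
      exact ⟨⟨x, (isSubcomplex_trunk hreg he k).1 hx⟩, hfT x hx⟩
    rcases Wedge.eq_base_or_inc w with rfl | ⟨j, v, rfl⟩
    · exact hbase
    · by_cases hv : v = sphereBase _
      · obtain ⟨x, hx⟩ := hbase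
        subst hv
        exact ⟨x, hx.trans (Wedge.inc_base (p := fun j : SphereIndex e => sphereBase (e j.1).1)
          j).symm⟩
      · obtain ⟨y, hy, rfl⟩ := exists_collapse_eq hv
        have hyI : map (e j.1).1 (e j.1).2 y ∈ innerCell (e j.1) := mem_image_of_mem _ hy
        refine ⟨⟨_, closedCell_subset_complex' _ (innerCell_subset_closedCell _ hyI)⟩, ?_⟩
        refine (hfI j _ hyI).trans ?_
        rw [hgm j y (ball_subset_closedBall hy)]
  · rintro ⟨x, hx⟩ ⟨y, hy⟩ hxy
    replace hxy : f x = f y := hxy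
    simp only [Subtype.mk.injEq]
    rcases hcover x hx with hxT | ⟨i, hi⟩ <;> rcases hcover y hy with hyT | ⟨j, hj⟩
    · exact .inr ⟨hxT, hyT⟩
    · rw [hfT x hxT, hfI j y hj, eq_comm, Wedge.inc_eq_base_iff] at hxy
      exact absurd hxy (hfB j y hj)
    · rw [hfT y hyT, hfI i x hi, Wedge.inc_eq_base_iff] at hxy
      exact absurd hxy (hfB i x hi)
    · rw [hfI i x hi, hfI j y hj] at hxy
      by_cases hij : i = j
      · subst hij
        obtain ⟨x, hx', rfl⟩ := hi
        obtain ⟨y, hy', rfl⟩ := hj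
        have := Wedge.inc_injective i hxy
        rw [hgm i x (ball_subset_closedBall hx'), hgm i y (ball_subset_closedBall hy')] at this
        exact .inl (congrArg _ (collapse_injOn hx' hy' this))
      · exact absurd (Wedge.eq_base_of_inc_eq_inc hij hxy) (hfB i x hi)

theorem isCompact_complex [RelCWComplex.Finite K] : IsCompact K := by
  have := finite_cells_of_finite (C := K)
  have : K = ⋃ c : Cell K, closedCell c := by
    refine subset_antisymm (fun x hx => ?_) (iUnion_subset closedCell_subset_complex')
    obtain ⟨c, hc⟩ := exists_mem_innerCell hx
    exact mem_iUnion.2 ⟨c, innerCell_subset_closedCell c hc⟩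
  rw [this]
  exact isCompact_iUnion fun c => isCompact_closedCell

/-- A regular complex with a topological shelling is homotopy equivalent to a wedge of spheres. -/
theorem IsTopologicalShelling.nonempty_homotopyEquiv_wedge [T2Space X] [RelCWComplex.Finite K]
    (he : IsTopologicalShelling e) (hreg : IsRegular K) (hne : K.Nonempty) :
    Nonempty (K ≃ₕ Wedge (fun j : SphereIndex e => Sphere (e j.1).1)
      (fun j : SphereIndex e => sphereBase (e j.1).1)) := by
  obtain ⟨x, hx⟩ := hne
  obtain ⟨i, -⟩ := he.exists_mem_closedCell hx
  have hT := isSubcomplex_trunk hreg he k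
  obtain ⟨a, ha, h, hh, hhT, hh0, hh1⟩ :=
    contractsIn_trunk hreg he (Nat.zero_lt_of_lt i.2) le_rfl
  -- The contraction of the trunk, extended to a homotopy of `K` that starts at the identity.
  obtain ⟨H, hH, hHK, hH0, hH1⟩ := (hreg.isCofib hT isSubcomplex_self hT.1).exists_extension
    hT.1 hT.isClosed isSubcomplex_self.isClosed (f := id) continuousOn_id hh hh0 (S := K)
    (fun _ hx => hx) (fun p hp => hT.1 (hhT hp))
  obtain ⟨q, hqs, hqT, hqf⟩ := exists_collapse_trunk hreg he ⟨a, ha⟩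
  have : CompactSpace K := isCompact_iff_compactSpace.1 isCompact_complex
  have hmem : ∀ p : I × K, (p.2.1, p.1) ∈ K ×ˢ (univ : Set I) := fun p => ⟨p.2.2, mem_univ _⟩
  refine nonempty_homotopyEquiv_of_collapse q hqs (T := {x | x.1 ∈ trunk e k})
    (fun x hx y hy => (hqT x hx).trans (hqT y hy).symm) hqf
    ⟨fun p => ⟨H (p.2.1, p.1), hHK (hmem p)⟩, Continuous.subtype_mk
      (hH.comp_continuous (f := fun p : I × K => (p.2.1, p.1)) (by fun_prop) hmem) _⟩
    (fun x => Subtype.ext (hH0 x.1 x.2)) (fun t x (hx : x.1 ∈ trunk e k) => ?_) (a := ⟨a, hT.1 ha⟩)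
    (fun x (hx : x.1 ∈ trunk e k) => Subtype.ext ?_)
  · show H (x.1, t) ∈ trunk e k
    rw [hH1 _ ⟨hx, mem_univ _⟩]
    exact hhT ⟨hx, mem_univ _⟩
  · show H (x.1, 1) = a
    rw [hH1 _ ⟨hx, mem_univ _⟩, hh1 _ hx]

end Main

end TopShelling

theorem mainTheorem5 {X : Type*} [TopologicalSpace X] [T2Space X] (K : Set X)
    [Topology.CWComplex K] [Topology.RelCWComplex.Finite K]
    (hreg : TopShelling.IsRegular K) (hne : K.Nonempty)
    {k : ℕ} (e : Fin k → TopShelling.Cell K) (he : TopShelling.IsTopologicalShelling e) :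
    Nonempty (K ≃ₕ TopShelling.Wedge
      (fun j : TopShelling.SphereIndex e => TopShelling.Sphere (e j.1).1)
      (fun j : TopShelling.SphereIndex e => TopShelling.sphereBase (e j.1).1)) :=
  he.nonempty_homotopyEquiv_wedge hreg hne
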